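/- Let $\mathbb{N}=\{1,2,\ldots\}$, let $n\ge 3$ be an integer and let $X_n=\{1,\ldots,n\}\times\mathbb{N}$. Let permutations act on the right, so that in a product the left factor is applied first. For $k\in\{2,\ldots,n\}$ let $g_k$ be the permutation of $X_n$ with $(1,m)g_k=(1,m+1)$ for all $m\ge 1$, $(k,1)g_k=(1,1)$, $(k,m)g_k=(k,m-1)$ for all $m\ge 2$, and $(i,m)g_k=(i,m)$ for $i\notin\{1,k\}$. Let $H_n=\langle g_2,\ldots,g_n\rangle$ be the $n$-th Houghton group, and let $\mathrm{Alt}(X_n)$ be the group of even permutations of $X_n$ with finite support. For a finitely generated group $G$ let $d(G)$ denote the least size of a generating set of $G$. For every ${\bf c}=(c_2,\ldots,c_n)\in\mathbb{N}^{n-1}$, the group $G_{\bf c}=\langle \mathrm{Alt}(X_n), g_2^{c_2},\ldots,g_n^{c_n}\rangle$ is finitely generated and $d(G_{\bf c})=d(H_n)=n-1$. Moreover, there is $\sigma\in\mathrm{Alt}(X_n)$ such that $G_{\bf c}$ is generated by $\{\sigma g_2^{c_2}, g_3^{c_3},\ldots,g_n^{c_n}\}$. -/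

import Mathlib

namespace Houghton

/-- `Alt(X)` for an arbitrary set `X`: the group of even finitary permutations of `X`, that is, of
the products of an even number of transpositions. -/
def altGroup (X : Type*) [DecidableEq X] : Subgroup (Equiv.Perm X) where
  carrier := {σ | ∃ l : List (Equiv.Perm X),
    (∀ τ ∈ l, Equiv.Perm.IsSwap τ) ∧ Even l.length ∧ l.prod = σ}
  one_mem' := ⟨[], by simp⟩
  mul_mem' := by
    rintro _ _ ⟨l, hl, hle, rfl⟩ ⟨l', hl', hle', rfl⟩
    refine ⟨l ++ l', ?_, ?_, by simp⟩
    · intro τ hτ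
      rcases List.mem_append.1 hτ with h | h
      · exact hl τ h
      · exact hl' τ h
    · rw [List.length_append]
      exact hle.add hle'
  inv_mem' := by
    rintro _ ⟨l, hl, hle, rfl⟩
    refine ⟨(l.map (·⁻¹)).reverse, ?_, by simpa using hle, (List.prod_inv_reverse l).symm⟩
    intro τ hτ
    obtain ⟨ρ, hρ, rfl⟩ := List.mem_map.1 (List.mem_reverse.1 hτ)
    obtain ⟨x, y, hxy, rfl⟩ := hl ρ hρ
    exact ⟨x, y, hxy, Equiv.swap_inv x y⟩

/-- The set `X_n = {1, …, n} × {1, 2, …}`, with both coordinates numbered from `0`: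
the pair `(i, m)` here is the point `(i + 1, m + 1)` of `X_n`. -/
abbrev Pt (n : ℕ) : Type := Fin n × ℕ

/-- The permutations `g_2, …, g_n` of `X_n`; here `g n j` is `g_{j + 2}`, for `j = 0, …, n - 2`.
It moves the first branch one step outwards, moves the branch with (0-based) number `j + 1` one
step inwards, sends the first point of that branch to the first point of the first branch,
and fixes all other points. -/
def g (n : ℕ) (j : Fin (n - 1)) : Equiv.Perm (Pt n) where
  toFun x :=
    if (x.1 : ℕ) = 0 then (x.1, x.2 + 1)
    else if (x.1 : ℕ) = j + 1 then
      if x.2 = 0 then ((⟨0, x.1.pos⟩ : Fin n), 0) else (x.1, x.2 - 1)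
    else x
  invFun x :=
    if (x.1 : ℕ) = 0 then
      if x.2 = 0 then (⟨j + 1, by omega⟩, 0) else (x.1, x.2 - 1)
    else if (x.1 : ℕ) = j + 1 then (x.1, x.2 + 1)
    else x
  left_inv := by
    rintro ⟨⟨i, hi⟩, m⟩
    rcases Nat.eq_zero_or_pos i with h | h <;> rcases eq_or_ne i (j + 1) with h' | h' <;>
      rcases Nat.eq_zero_or_pos m with h'' | h'' <;> simp_all <;> grind
  right_inv := by
    rintro ⟨⟨i, hi⟩, m⟩
    rcases Nat.eq_zero_or_pos i with h | h <;> rcases eq_or_ne i (j + 1) with h' | h' <;>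
      rcases Nat.eq_zero_or_pos m with h'' | h'' <;> simp_all <;> grind

/-- The `n`-th Houghton group `H_n = ⟨g_2, …, g_n⟩` (for `n ≥ 3`). -/
def H (n : ℕ) : Subgroup (Equiv.Perm (Pt n)) :=
  Subgroup.closure (Set.range (g n))

/-- The group `G_c = ⟨Alt(X_n), g_2^{c_2}, …, g_n^{c_n}⟩`, where `c j` is `c_{j + 2}`. -/
def G (n : ℕ) (c : Fin (n - 1) → ℕ) : Subgroup (Equiv.Perm (Pt n)) :=
  Subgroup.closure ((altGroup (Pt n) : Set (Equiv.Perm (Pt n))) ∪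
    Set.range (fun j => g n j ^ c j))

end Houghton

/-!
The lower bound for the ranks comes from translation lengths. Every element of `H n` and of `G n c`
is eventually a translation on each branch, and its translation lengths on the branches with
positive number form a vector in `ℚ ^ (n - 1)` that depends additively on the element. The vectors
of a generating set span those of the powers `g n j ^ c j`, which are nonzero multiples of the
standard basis vectors; hence there are at least `n - 1` generators (`sub_one_le_rank`).

The upper bound for `G n c` is the statement about `σ`. Write `γ` for the power of the first
generator, `β` for the inverse of the power of the second one, so that `β` pushes branch `2`
outwards by `d` steps, and let `σ` be a cycle of prime length `q` on points of branch `2`, all of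
them fixed by `γ`. Let `Γ` be the group generated by `γ * σ` and the other powers.

* The commutator of `γ * σ` and `β` is the product of `κ = γ * β * γ⁻¹ * β⁻¹`, which has finite
  support near the origin, and of `σ * (β * σ * β⁻¹)⁻¹`. If the supports of these factors are
  disjoint and `q` exceeds the order of `κ`, a power of the commutator is the second factor alone,
  so `Γ` contains `σ * β * σ⁻¹` (`mul_mul_inv_mem_of_coprime`).
* Therefore `Γ` contains `σ` times a conjugate of `σ⁻¹` by an arbitrarily high power of `β`, so
  that `σ` normalizes the set of three-cycles of `Γ` (`mem_threeCycleNormalizer_of_ray`), and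
  `Γ` contains the commutator of `σ` and `β ^ 2 * σ * (β ^ 2)⁻¹` (`commutator_mem_of_ray`). The
  support of `σ` meets its shift by `2 * d` in one point only, so this commutator is a three-cycle.
* Being moved by a common three-cycle of `Γ` is an equivalence relation (`Linked`), since two
  three-cycles that share a point generate the alternating group of their joint support. The
  relation is invariant under `Γ` and `σ`, hence under all `g n j ^ c j`. The pattern of the support
  of `σ` makes all points of branch `2` equivalent (`linked_ray`), and the `g n j ^ c j` carry all
  other points there (`linked_of_linked_branch`). So `Γ` contains all three-cycles, and thereby
  `altGroup (Pt n)` (`altGroup_le_of_linked`).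
-/

namespace Houghton

open Equiv Equiv.Perm

/-! ### Three-cycles in a permutation group -/

section ThreeCycles

variable {X : Type*} [DecidableEq X] {Γ : Subgroup (Perm X)} {x y z u v w : X}

/-- The points `x, y, z` are distinct and the three-cycle `x ↦ y ↦ z ↦ x` lies in `Γ`. -/
def HasThreeCycle (Γ : Subgroup (Perm X)) (x y z : X) : Prop :=
  x ≠ y ∧ y ≠ z ∧ x ≠ z ∧ swap x y * swap y z ∈ Γ

/-- The points `x` and `y` are equal, or some three-cycle in `Γ` moves both of them. -/
def Linked (Γ : Subgroup (Perm X)) (x y : X) : Prop :=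
  x = y ∨ ∃ z, HasThreeCycle Γ x y z

lemma swap_mul_swap_rotate (hxy : x ≠ y) (hxz : x ≠ z) :
    swap x y * swap y z = swap y z * swap z x := by
  have h := Equiv.swap_apply_apply (swap y z) x y
  rw [swap_apply_of_ne_of_ne hxy hxz, swap_apply_left, swap_inv] at h
  rw [swap_comm z x, h]
  simp [← mul_assoc]

lemma HasThreeCycle.rotate (h : HasThreeCycle Γ x y z) : HasThreeCycle Γ y z x :=
  ⟨h.2.1, h.2.2.1.symm, h.1.symm, swap_mul_swap_rotate h.1 h.2.2.1 ▸ h.2.2.2⟩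

lemma HasThreeCycle.reverse (h : HasThreeCycle Γ x y z) : HasThreeCycle Γ z y x := by
  refine ⟨h.2.1.symm, h.1.symm, h.2.2.1.symm, ?_⟩
  have := Γ.inv_mem h.2.2.2
  rwa [mul_inv_rev, swap_inv, swap_inv, swap_comm y z, swap_comm x y] at this

lemma HasThreeCycle.map_of_mul_mul_inv_mem {f : Perm X} (h : HasThreeCycle Γ x y z)
    (hf : f * (swap x y * swap y z) * f⁻¹ ∈ Γ) : HasThreeCycle Γ (f x) (f y) (f z) := by
  refine ⟨f.injective.ne h.1, f.injective.ne h.2.1, f.injective.ne h.2.2.1, ?_⟩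
  rw [Equiv.swap_apply_apply, Equiv.swap_apply_apply]
  convert hf using 1
  group

lemma HasThreeCycle.map {f : Perm X} (hf : f ∈ Γ) (h : HasThreeCycle Γ x y z) :
    HasThreeCycle Γ (f x) (f y) (f z) :=
  h.map_of_mul_mul_inv_mem (Γ.mul_mem (Γ.mul_mem hf h.2.2.2) (Γ.inv_mem hf))

lemma HasThreeCycle.linked (h : HasThreeCycle Γ x y z) : Linked Γ x y :=
  Or.inr ⟨z, h⟩

/-- Two three-cycles sharing the point `y` generate every even permutation of their joint support;
here the one on `x, y, z` is written as an iterated conjugate. -/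
lemma HasThreeCycle.of_linked (hxy : x ≠ y) (hyz : y ≠ z) (hxz : x ≠ z)
    (h₁ : Linked Γ x y) (h₂ : Linked Γ y z) : HasThreeCycle Γ x y z := by
  obtain ⟨u, hu⟩ := h₁.resolve_left hxy
  obtain ⟨v, hv⟩ := h₂.resolve_left hyz
  rcases eq_or_ne u z with rfl | huz
  · exact hu
  rcases eq_or_ne v x with rfl | hvx
  · exact hv.rotate.rotate
  have key := hu.map hv.2.2.2
  have e₁ : (swap y z * swap z v) x = x := by
    simp [Perm.mul_apply, swap_apply_of_ne_of_ne hxz hvx.symm, swap_apply_of_ne_of_ne hxy hxz]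
  have e₂ : (swap y z * swap z v) y = z := by
    simp [Perm.mul_apply, swap_apply_of_ne_of_ne hyz hv.2.2.1]
  rw [e₁, e₂] at key
  rcases eq_or_ne u v with rfl | huv
  · have e₃ : (swap y z * swap z u) u = y := by simp [Perm.mul_apply]
    rw [e₃] at key
    exact key.reverse.rotate.rotate
  · have e₃ : (swap y z * swap z v) u = u := by
      simp [Perm.mul_apply, swap_apply_of_ne_of_ne huz huv,
        swap_apply_of_ne_of_ne hu.2.1.symm huz]
    rw [e₃] at key
    have key' := hu.map key.2.2.2
    have f₁ : (swap x z * swap z u) x = z := by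
      simp [Perm.mul_apply, swap_apply_of_ne_of_ne hxz hu.2.2.1]
    have f₂ : (swap x z * swap z u) y = y := by
      simp [Perm.mul_apply, swap_apply_of_ne_of_ne hyz hu.2.1,
        swap_apply_of_ne_of_ne hxy.symm hyz]
    have f₃ : (swap x z * swap z u) u = x := by simp [Perm.mul_apply]
    rw [f₁, f₂, f₃] at key'
    exact key'.reverse

lemma Linked.refl (x : X) : Linked Γ x x := Or.inl rfl

lemma Linked.symm (h : Linked Γ x y) : Linked Γ y x := by
  rcases h with rfl | ⟨z, h⟩
  · exact Linked.refl x
  · exact h.reverse.rotate.linked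

lemma Linked.trans (h₁ : Linked Γ x y) (h₂ : Linked Γ y z) : Linked Γ x z := by
  rcases eq_or_ne x y with rfl | hxy
  · exact h₂
  rcases eq_or_ne y z with rfl | hyz
  · exact h₁
  rcases eq_or_ne x z with rfl | hxz
  · exact Linked.refl x
  exact (HasThreeCycle.of_linked hxy hyz hxz h₁ h₂).rotate.rotate.linked.symm

variable (Γ) in
/-- The permutations `f` of `X` such that a three-cycle lies in `Γ` if and only if its conjugate
by `f` does. -/
def threeCycleNormalizer : Subgroup (Perm X) where
  carrier := {f | ∀ x y z, HasThreeCycle Γ (f x) (f y) (f z) ↔ HasThreeCycle Γ x y z}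
  one_mem' _ _ _ := Iff.rfl
  mul_mem' {f f'} hf hf' x y z := (hf (f' x) (f' y) (f' z)).trans (hf' x y z)
  inv_mem' {f} hf x y z := by simpa using (hf (f⁻¹ x) (f⁻¹ y) (f⁻¹ z)).symm

lemma le_threeCycleNormalizer : Γ ≤ threeCycleNormalizer Γ := fun f hf x y z =>
  ⟨fun h => by simpa using h.map (Γ.inv_mem hf), fun h => h.map hf⟩

lemma linked_apply_iff {f : Perm X} (hf : f ∈ threeCycleNormalizer Γ) :
    Linked Γ (f x) (f y) ↔ Linked Γ x y := by
  refine or_congr f.injective.eq_iff ⟨fun ⟨z, hz⟩ => ⟨f⁻¹ z, ?_⟩, fun ⟨z, hz⟩ => ⟨f z, ?_⟩⟩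
  · exact (hf x y (f⁻¹ z)).1 (by simpa using hz)
  · exact (hf x y z).2 hz

/-- If `f` normalizes the three-cycles of `Γ` and some point linked to `x` is sent by `f` to a point
linked to `x`, then `f` preserves the set of all points linked to `x`. -/
lemma linked_apply_right_iff {f : Perm X} (hf : f ∈ threeCycleNormalizer Γ)
    (hy : Linked Γ x y) (hfy : Linked Γ x (f y)) : Linked Γ x (f z) ↔ Linked Γ x z := by
  refine ⟨fun h => hy.trans ?_, fun h => hfy.trans ?_⟩
  · exact (linked_apply_iff hf).1 (hfy.symm.trans h)
  · exact (linked_apply_iff hf).2 (hy.symm.trans h)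

lemma linked_pow_apply_right_iff {f : Perm X} (hf : f ∈ threeCycleNormalizer Γ)
    (hy : Linked Γ x y) (hfy : Linked Γ x (f y)) (t : ℕ) :
    Linked Γ x ((f ^ t) z) ↔ Linked Γ x z := by
  induction t with
  | zero => simp
  | succ t ih => rw [pow_succ', Perm.mul_apply, linked_apply_right_iff hf hy hfy, ih]

lemma swap_mul_swap_mem_of_linked (h : ∀ x y, Linked Γ x y) {a b c d : X}
    (hab : a ≠ b) (hcd : c ≠ d) : swap a b * swap c d ∈ Γ := by
  have key : ∀ {a b c : X}, a ≠ b → b ≠ c → swap a b * swap b c ∈ Γ := by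
    intro a b c hab hbc
    rcases eq_or_ne a c with rfl | hac
    · rw [swap_comm b a, swap_mul_self]
      exact Γ.one_mem
    · exact (HasThreeCycle.of_linked hab hbc hac (h _ _) (h _ _)).2.2.2
  rcases eq_or_ne b c with rfl | hbc
  · exact key hab hcd
  · have := Γ.mul_mem (key hab hbc) (key hbc hcd)
    rwa [mul_assoc, swap_mul_self_mul] at this

theorem altGroup_le_of_linked (h : ∀ x y, Linked Γ x y) : altGroup X ≤ Γ := by
  rintro _ ⟨l, hl, hle, rfl⟩
  induction l using List.twoStepInduction with
  | nil => exact Γ.one_mem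
  | singleton a => simp at hle
  | cons_cons s t l ih _ =>
    obtain ⟨a, b, hab, rfl⟩ := hl s (by simp)
    obtain ⟨c, d, hcd, rfl⟩ := hl t (by simp)
    rw [List.prod_cons, List.prod_cons, ← mul_assoc]
    refine Γ.mul_mem (swap_mul_swap_mem_of_linked h hab hcd) (ih ?_ ?_)
    · exact fun τ hτ => hl τ (by simp [hτ])
    · simpa [Nat.even_add, parity_simps] using hle

end ThreeCycles

/-! ### Permutations with prescribed support -/

section Support

variable {X : Type*}

/-- The permutations of `X` that fix every point outside `A`. -/
def supportedOn (A : Set X) : Subgroup (Perm X) := fixingSubgroup (Perm X) Aᶜ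

lemma mem_supportedOn {A : Set X} {f : Perm X} : f ∈ supportedOn A ↔ ∀ x ∉ A, f x = x :=
  mem_fixingSubgroup_iff _

lemma supportedOn_mono {A B : Set X} (h : A ⊆ B) : supportedOn A ≤ supportedOn B :=
  fun _ hf => mem_supportedOn.2 fun x hx => mem_supportedOn.1 hf x fun hA => hx (h hA)

lemma commute_of_mem_supportedOn {A B : Set X} {f f' : Perm X} (hAB : Disjoint A B)
    (hf : f ∈ supportedOn A) (hf' : f' ∈ supportedOn B) : Commute f f' := by
  refine Perm.Disjoint.commute fun x => ?_
  by_cases hx : x ∈ A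
  · exact Or.inr (mem_supportedOn.1 hf' x (hAB.notMem_of_mem_left hx))
  · exact Or.inl (mem_supportedOn.1 hf x hx)

lemma mul_mul_inv_mem_supportedOn {A B : Set X} {f h : Perm X} (hf : f ∈ supportedOn A)
    (hAB : ∀ x ∈ A, h x ∈ B) : h * f * h⁻¹ ∈ supportedOn B := by
  refine mem_supportedOn.2 fun x hx => ?_
  have : h⁻¹ x ∉ A := fun hA => hx (by simpa using hAB _ hA)
  rw [Perm.mul_apply, Perm.mul_apply, mem_supportedOn.1 hf _ this]
  exact h.apply_symm_apply x

lemma isOfFinOrder_of_mem_supportedOn {A : Set X} (hA : A.Finite) {f : Perm X}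
    (hf : f ∈ supportedOn A) : IsOfFinOrder f := by
  classical
  have := hA.to_subtype
  have hmap : ∀ x, f x ∈ A ↔ x ∈ A := fun x => by
    by_cases hx : x ∈ A
    · refine ⟨fun _ => hx, fun _ => by_contra fun h => ?_⟩
      rw [f.injective (mem_supportedOn.1 hf _ h)] at h
      exact h hx
    · rw [mem_supportedOn.1 hf x hx]
  have e : ofSubtype (f.subtypePerm hmap) = f :=
    ofSubtype_subtypePerm hmap fun x hx => by_contra fun h => hx (mem_supportedOn.1 hf x h)
  rw [← e]
  exact MonoidHom.isOfFinOrder _ (isOfFinOrder_of_finite _)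

lemma formPerm_mem_supportedOn [DecidableEq X] (l : List X) :
    l.formPerm ∈ supportedOn {x | x ∈ l} :=
  mem_supportedOn.2 fun _ hx => List.formPerm_apply_of_notMem hx

lemma formPerm_mem_altGroup [DecidableEq X] {l : List X} (hl : l.Nodup) (hodd : Odd l.length) :
    l.formPerm ∈ altGroup X := by
  refine ⟨List.zipWith swap l l.tail, ?_, ?_, rfl⟩
  · intro τ hτ
    obtain ⟨i, hi, rfl⟩ := List.getElem_of_mem hτ
    rw [List.getElem_zipWith, List.getElem_tail]
    refine ⟨_, _, fun h => ?_, rfl⟩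
    have := (hl.getElem_inj_iff).1 h
    omega
  · obtain ⟨k, hk⟩ := hodd
    simp [hk]

/-- The commutator of two permutations whose supports have exactly one common point `q` is a
three-cycle: after splitting off the transposition `swap q (f' q)` from `f'`, the remaining factor
fixes `q` and hence commutes with `f`. -/
lemma mul_mul_inv_mul_inv_eq_swap_mul_swap [DecidableEq X] {A B : Set X} {f f' : Perm X} {q : X}
    (hf : f ∈ supportedOn A) (hf' : f' ∈ supportedOn B) (hAB : ∀ x ∈ A, x ∈ B → x = q)
    (hq : f' q ∉ A) : f * f' * f⁻¹ * f'⁻¹ = swap (f q) (f' q) * swap (f' q) q := by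
  have hcomm : Commute f (swap q (f' q) * f') := by
    refine Perm.Disjoint.commute fun x => ?_
    by_cases hx : x ∈ A
    · right
      rcases eq_or_ne x q with rfl | hxq
      · simp
      · have hxB : f' x = x := mem_supportedOn.1 hf' x fun h => hxq (hAB x hx h)
        rw [Perm.mul_apply, hxB, swap_apply_of_ne_of_ne hxq]
        rintro rfl
        exact hq hx
    · exact Or.inl (mem_supportedOn.1 hf x hx)
  have hfix : f (f' q) = f' q := mem_supportedOn.1 hf _ hq
  have e : swap (f q) (f' q) = f * swap q (f' q) * f⁻¹ := by
    rw [← Equiv.swap_apply_apply, hfix]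
  have e' : f' = swap q (f' q) * (swap q (f' q) * f') := by simp
  have e'' : f * f' * f⁻¹ * f'⁻¹ = (f * swap q (f' q) * f⁻¹) *
      (f * (swap q (f' q) * f') * f⁻¹ * (swap q (f' q) * f')⁻¹) * (swap q (f' q))⁻¹ := by
    have h2 : swap q (f' q) * swap q (f' q) = 1 := swap_mul_self _ _
    have h3 : (swap q (f' q))⁻¹ = swap q (f' q) := swap_inv _ _
    generalize swap q (f' q) = s at *
    simp only [mul_inv_rev, h3, mul_assoc, inv_mul_cancel_left, h2, mul_one]
    rw [← mul_assoc s s, h2, one_mul]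
  rw [e'', hcomm.eq, e]
  simp [mul_assoc, swap_comm (f' q) q]

/-- If `f` commutes with `γ`, if the commutator `γ * β * γ⁻¹ * β⁻¹` commutes with `f` and with
`β * f * β⁻¹` and has order prime to that of `f`, and if the last two commute as well, then the
group generated by `γ * f` and `β` contains `f * β * f⁻¹`: a suitable power of the commutator of the
two generators has no contribution from `γ` left. -/
lemma mul_mul_inv_mem_of_coprime {G : Type*} [Group G] {Γ : Subgroup G} {γ β f : G} {e p : ℕ}
    (hβ : β ∈ Γ) (hγf : γ * f ∈ Γ) (h₁ : Commute γ f) (h₂ : Commute (γ * β * γ⁻¹ * β⁻¹) f)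
    (h₃ : Commute (γ * β * γ⁻¹ * β⁻¹) (β * f * β⁻¹)) (h₄ : Commute f (β * f * β⁻¹))
    (he : (γ * β * γ⁻¹ * β⁻¹) ^ e = 1) (hp : f ^ p = 1) (hep : e.Coprime p) :
    f * β * f⁻¹ ∈ Γ := by
  set k := γ * β * γ⁻¹ * β⁻¹ with hk
  set y := f * (β * f * β⁻¹)⁻¹ with hy
  have hky : k * y ∈ Γ := by
    have : k * y = (γ * f) * β * (γ * f)⁻¹ * β⁻¹ := by
      rw [hy, ← mul_assoc, h₂.eq, hk, h₁.eq]
      group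
    rw [this]
    exact Γ.mul_mem (Γ.mul_mem (Γ.mul_mem hγf hβ) (Γ.inv_mem hγf)) (Γ.inv_mem hβ)
  have hyp : y ^ p = 1 := by
    rw [hy, (h₄.inv_right).mul_pow, inv_pow, conj_pow, hp]
    simp
  have hye : y ^ e ∈ Γ := by
    have := Γ.pow_mem hky e
    rwa [(h₂.mul_right h₃.inv_right : Commute k y).mul_pow, he, one_mul] at this
  obtain ⟨m, hm⟩ := exists_pow_eq_self_of_coprime
    (hep.coprime_dvd_right (orderOf_dvd_of_pow_eq_one hyp))
  have hyΓ : y ∈ Γ := hm ▸ Γ.pow_mem hye m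
  have : f * β * f⁻¹ = y * β := by rw [hy]; group
  exact this ▸ Γ.mul_mem hyΓ hβ

end Support

/-! ### A long cycle along a shifted ray -/

/-- A list of `r + 2` natural numbers, starting with `3 * d` and `6 * d`, in which the difference
`d` does not occur, the difference `2 * d` occurs only between `3 * d` and `d`, the difference
`5 * d` occurs between `6 * d` and `d` (if `0 < r`), and which meets all residue classes modulo `d`
if `0 < d ≤ r`. -/
def spreadList (d r : ℕ) : List ℕ :=
  3 * d :: 6 * d :: (List.range r).map fun k => d + k * (10 * d + 1)

lemma mem_spreadList {d r x : ℕ} : x ∈ spreadList d r ↔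
    x = 3 * d ∨ x = 6 * d ∨ ∃ k < r, d + k * (10 * d + 1) = x := by
  simp [spreadList]

@[simp] lemma length_spreadList (d r : ℕ) : (spreadList d r).length = r + 2 := by
  simp [spreadList]

lemma le_of_mem_spreadList {d r x : ℕ} (hx : x ∈ spreadList d r) : d ≤ x := by
  rcases mem_spreadList.1 hx with rfl | rfl | ⟨k, -, rfl⟩ <;> omega

/-- The steps of the arithmetic progression in `spreadList` exceed `10 * d`. -/
lemma add_mul_eq_add_mul {d k k' e : ℕ} (he : e ≤ 10 * d)
    (h : k * (10 * d + 1) + e = k' * (10 * d + 1)) : k = k' ∧ e = 0 := by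
  have hk : k = k' := by
    have h1 : (k * (10 * d + 1) + e) / (10 * d + 1) = k := by
      rw [mul_comm, Nat.mul_add_div (by omega), Nat.div_eq_of_lt (by omega), add_zero]
    rw [← h1, h, Nat.mul_div_cancel _ (by omega)]
  subst hk
  exact ⟨rfl, by omega⟩

lemma nodup_spreadList {d : ℕ} (hd : 0 < d) (r : ℕ) : (spreadList d r).Nodup := by
  have h1 : ∀ k e, 0 < e → e ≤ 10 * d → d + k * (10 * d + 1) ≠ d + e := fun k e he he' h => by
    have := add_mul_eq_add_mul (k := 0) (k' := k) (d := d) he' (by omega)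
    omega
  refine List.nodup_cons.2 ⟨?_, List.nodup_cons.2 ⟨?_, List.Nodup.map ?_ List.nodup_range⟩⟩
  · simp only [List.mem_cons, List.mem_map, List.mem_range, not_or, not_exists, not_and]
    exact ⟨by omega, fun k _ h => h1 k (2 * d) (by omega) (by omega) (by omega)⟩
  · simp only [List.mem_map, List.mem_range, not_exists, not_and]
    exact fun k _ h => h1 k (5 * d) (by omega) (by omega) (by omega)
  · intro k k' h
    exact (add_mul_eq_add_mul (d := d) (e := 0) (by omega) (by simpa using h)).1

lemma add_notMem_spreadList {d r x : ℕ} (hd : 0 < d) (hx : x ∈ spreadList d r) :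
    x + d ∉ spreadList d r := by
  intro hy
  rcases mem_spreadList.1 hx with rfl | rfl | ⟨k, -, rfl⟩ <;>
    rcases mem_spreadList.1 hy with h | h | ⟨k', -, h⟩
  · omega
  · omega
  · have := @add_mul_eq_add_mul d 0 k' (3 * d) (by omega) (by omega)
    omega
  · omega
  · omega
  · have := @add_mul_eq_add_mul d 0 k' (6 * d) (by omega) (by omega)
    omega
  · have := @add_mul_eq_add_mul d 0 k d (by omega) (by omega)
    omega
  · have := @add_mul_eq_add_mul d 0 k (4 * d) (by omega) (by omega)
    omega
  · have := @add_mul_eq_add_mul d k k' d (by omega) (by omega)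
    omega

lemma eq_of_add_two_mul_mem_spreadList {d r x : ℕ} (hd : 0 < d) (hx : x ∈ spreadList d r)
    (hy : x + 2 * d ∈ spreadList d r) : x = d := by
  rcases mem_spreadList.1 hx with rfl | rfl | ⟨k, -, rfl⟩ <;>
    rcases mem_spreadList.1 hy with h | h | ⟨k', -, h⟩
  · omega
  · omega
  · have := @add_mul_eq_add_mul d 0 k' (4 * d) (by omega) (by omega)
    omega
  · omega
  · omega
  · have := @add_mul_eq_add_mul d 0 k' (7 * d) (by omega) (by omega)
    omega
  · have := @add_mul_eq_add_mul d 0 k 0 (by omega) (by omega)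
    omega
  · have := @add_mul_eq_add_mul d 0 k (3 * d) (by omega) (by omega)
    omega
  · have := @add_mul_eq_add_mul d k k' (2 * d) (by omega) (by omega)
    omega

section Ray

variable {X : Type*} {β : Perm X} {p : ℕ → X} {d : ℕ}

lemma pow_apply_ray (hβp : ∀ k, β (p k) = p (k + d)) (t k : ℕ) : (β ^ t) (p k) = p (k + t * d) := by
  induction t with
  | zero => simp
  | succ t ih => rw [pow_succ', Perm.mul_apply, ih, hβp]; congr 1; ring

variable {Γ : Subgroup (Perm X)}

/-- The commutator of `f` and its conjugate `β ^ 2 * f * (β ^ 2)⁻¹` lies in `Γ`: both may be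
multiplied by conjugates of `f⁻¹` that are supported so far out that they do not contribute to
the commutator. -/
lemma commutator_mem_of_ray (hp : Function.Injective p)
    (hβp : ∀ k, β (p k) = p (k + d)) (hβ : β ∈ Γ) {f : Perm X} {N : ℕ} (hd : 0 < d)
    (hf : f ∈ supportedOn (p '' Set.Ico 0 N)) (hfβ : f * β * f⁻¹ ∈ Γ) :
    f * (β ^ 2 * f * (β ^ 2)⁻¹) * f⁻¹ * (β ^ 2 * f * (β ^ 2)⁻¹)⁻¹ ∈ Γ := by
  have hmem : ∀ t, f * β ^ t * f⁻¹ ∈ Γ := fun t => conj_pow (a := f) (b := β) ▸ Γ.pow_mem hfβ t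
  have hsupp : ∀ {f' : Perm X}, f' ∈ supportedOn (p '' Set.Ico 0 N) → ∀ t,
      β ^ t * f' * (β ^ t)⁻¹ ∈ supportedOn (p '' Set.Ico (t * d) (N + t * d)) := by
    intro f' hf' t
    refine mul_mul_inv_mem_supportedOn hf' ?_
    rintro _ ⟨k, hk, rfl⟩
    exact ⟨k + t * d, ⟨by omega, by have := hk.2; omega⟩, (pow_apply_ray hβp _ _).symm⟩
  have hcomm : ∀ {f₁ f₂ : Perm X} {a b a' b' : ℕ}, f₁ ∈ supportedOn (p '' Set.Ico a b) →
      f₂ ∈ supportedOn (p '' Set.Ico a' b') → b' ≤ a → Commute f₁ f₂ := by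
    intro f₁ f₂ a b a' b' h₁ h₂ hab
    refine commute_of_mem_supportedOn ?_ h₁ h₂
    rw [Set.disjoint_image_iff hp, Set.disjoint_left]
    intro k hk hk'
    exact absurd hk.1 (by have := hk'.2; omega)
  have hf' := (supportedOn (p '' Set.Ico 0 N)).inv_mem hf
  have h₂ := hsupp hf 2
  have h₃ := hsupp hf' (N + 2)
  have h₄ := hsupp hf' (N + (N + 2))
  have hNd : N ≤ N * d := Nat.le_mul_of_pos_right _ hd
  have h₃₂ := hcomm h₃ h₂ (by rw [add_mul N 2]; omega)
  have h₄₃ := hcomm h₄ h₃ (by rw [add_mul N (N + 2)]; omega)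
  have h₄₁ := hcomm h₄ hf (by rw [add_mul N (N + 2)]; omega)
  have hz : f * (β ^ (N + 2) * f⁻¹ * (β ^ (N + 2))⁻¹) ∈ Γ := by
    have := Γ.mul_mem (hmem (N + 2)) (Γ.inv_mem (Γ.pow_mem hβ (N + 2)))
    simpa only [mul_assoc] using this
  have hz' : (β ^ 2 * f * (β ^ 2)⁻¹) * (β ^ (N + (N + 2)) * f⁻¹ * (β ^ (N + (N + 2)))⁻¹) ∈ Γ := by
    have := Γ.mul_mem (Γ.mul_mem (Γ.pow_mem hβ 2) (hmem (N + N)))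
      (Γ.inv_mem (Γ.pow_mem hβ (N + (N + 2))))
    convert this using 1
    group
  have := Γ.mul_mem (Γ.mul_mem (Γ.mul_mem hz hz') (Γ.inv_mem hz)) (Γ.inv_mem hz')
  generalize β ^ 2 * f * (β ^ 2)⁻¹ = f₂ at *
  generalize β ^ (N + 2) * f⁻¹ * (β ^ (N + 2))⁻¹ = f₃ at *
  generalize β ^ (N + (N + 2)) * f⁻¹ * (β ^ (N + (N + 2)))⁻¹ = f₄ at *
  have e : f * f₃ * (f₂ * f₄) * (f * f₃)⁻¹ * (f₂ * f₄)⁻¹ = f * f₂ * f⁻¹ * f₂⁻¹ := by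
    have e₁ : f₃ * (f₂ * f₄) * f₃⁻¹ = f₂ * f₄ := by
      rw [(h₃₂.mul_right h₄₃.symm).eq, mul_inv_cancel_right]
    have e₂ : f₄ * f⁻¹ * f₄⁻¹ = f⁻¹ := by
      rw [h₄₁.inv_right.eq, mul_inv_cancel_right]
    calc _ = f * (f₃ * (f₂ * f₄) * f₃⁻¹) * f⁻¹ * (f₂ * f₄)⁻¹ := by group
      _ = f * f₂ * (f₄ * f⁻¹ * f₄⁻¹) * f₂⁻¹ := by rw [e₁]; group
      _ = _ := by rw [e₂]
  exact e ▸ this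

variable [DecidableEq X]

/-- If `β` shifts the ray `p` and `f` is supported on an initial segment of it, then `f` agrees on
any given finite set with `f * β ^ m * f⁻¹ * (β ^ m)⁻¹` for large `m`. -/
lemma mem_threeCycleNormalizer_of_ray (hd : 0 < d) (hp : Function.Injective p)
    (hβp : ∀ k, β (p k) = p (k + d)) (hβ : β ∈ Γ) {f : Perm X} {N : ℕ}
    (hf : f ∈ supportedOn (p '' Set.Ico 0 N)) (hfβ : f * β * f⁻¹ ∈ Γ) :
    f ∈ threeCycleNormalizer Γ := by
  have key : ∀ x y z, ∃ h ∈ Γ, f x = h x ∧ f y = h y ∧ f z = h z := by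
    intro x y z
    have hfin : (p ⁻¹' {x, y, z}).Finite :=
      (Set.toFinite {x, y, z}).preimage hp.injOn
    obtain ⟨m, hm⟩ := hfin.bddAbove
    have hD : β ^ (m + 1) * f⁻¹ * (β ^ (m + 1))⁻¹ ∈ supportedOn (p '' Set.Ici (m + 1)) := by
      refine mul_mul_inv_mem_supportedOn ((supportedOn _).inv_mem hf) ?_
      rintro _ ⟨k, -, rfl⟩
      refine ⟨k + (m + 1) * d, ?_, (pow_apply_ray hβp _ _).symm⟩
      exact (Nat.le_mul_of_pos_right _ hd).trans (Nat.le_add_left _ _)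
    have hfix : ∀ w ∈ ({x, y, z} : Set X), (β ^ (m + 1) * f⁻¹ * (β ^ (m + 1))⁻¹) w = w := by
      refine fun w hw => mem_supportedOn.1 hD w ?_
      rintro ⟨k, hk, rfl⟩
      exact absurd (hm hw) (by simpa using hk)
    refine ⟨f * (β ^ (m + 1) * f⁻¹ * (β ^ (m + 1))⁻¹), ?_, ?_, ?_, ?_⟩
    · have : f * (β ^ (m + 1) * f⁻¹ * (β ^ (m + 1))⁻¹) =
          (f * β * f⁻¹) ^ (m + 1) * (β ^ (m + 1))⁻¹ := by
        rw [conj_pow]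
        group
      rw [this]
      exact Γ.mul_mem (Γ.pow_mem hfβ _) (Γ.inv_mem (Γ.pow_mem hβ _))
    all_goals rw [Perm.mul_apply, hfix _ (by simp)]
  intro x y z
  obtain ⟨h, hΓ, hx, hy, hz⟩ := key x y z
  rw [hx, hy, hz]
  exact le_threeCycleNormalizer hΓ x y z

lemma linked_getElem_of_formPerm {l : List X} (hl : l.Nodup)
    (hf : l.formPerm ∈ threeCycleNormalizer Γ) (h0 : 0 < l.length)
    (h : Linked Γ l[0] (l.formPerm l[0])) (i : ℕ) (hi : i < l.length) : Linked Γ l[0] l[i] := by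
  induction i with
  | zero => exact Linked.refl _
  | succ i ih =>
    rw [← List.formPerm_apply_lt_getElem l hl i hi]
    exact (linked_apply_right_iff hf (Linked.refl _) h).2 (ih (by omega))

/-- If `β` shifts the ray `p` by `d`, and `f` is the cycle along `p` with pattern `spreadList d r`,
then a group that contains `β` and `f * β * f⁻¹` has enough three-cycles to link all points of
the ray. -/
theorem linked_ray (hd : 0 < d) {r : ℕ} (hr : d ≤ r) (hp : Function.Injective p)
    (hβp : ∀ k, β (p k) = p (k + d)) (hβ : β ∈ Γ)
    (hfβ : ((spreadList d r).map p).formPerm * β * ((spreadList d r).map p).formPerm⁻¹ ∈ Γ) :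
    ((spreadList d r).map p).formPerm ∈ threeCycleNormalizer Γ ∧
      ∀ k, Linked Γ (p d) (p k) := by
  set l := (spreadList d r).map p with hl
  set f := l.formPerm with hf
  have hnodup : l.Nodup := (nodup_spreadList hd r).map hp
  have hlen : l.length = r + 2 := by simp [hl]
  have hfl : f ∈ supportedOn {x | x ∈ l} := formPerm_mem_supportedOn l
  have hmeml : ∀ k, p k ∈ l ↔ k ∈ spreadList d r := fun k => List.mem_map_of_injective hp
  obtain ⟨N, hN⟩ : ∃ N, ∀ k ∈ spreadList d r, k < N :=
    ⟨(spreadList d r).sum + 1, fun k hk => Nat.lt_succ_of_le (List.le_sum_of_mem hk)⟩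
  have hfN : f ∈ supportedOn (p '' Set.Ico 0 N) := by
    refine supportedOn_mono ?_ hfl
    rintro x hx
    obtain ⟨k, hk, rfl⟩ := List.mem_map.1 hx
    exact ⟨k, ⟨Nat.zero_le _, hN k hk⟩, rfl⟩
  have hnorm : f ∈ threeCycleNormalizer Γ := mem_threeCycleNormalizer_of_ray hd hp hβp hβ hfN hfβ
  refine ⟨hnorm, ?_⟩
  have hl0 : l[0] = p (3 * d) := by simp [hl, spreadList]
  -- The commutator of `f` and `β ^ 2 * f * (β ^ 2)⁻¹` is a three-cycle through `p (3 * d)`, the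
  -- only common point of the two supports.
  have hlink0 : Linked Γ (p (3 * d)) (f (p (3 * d))) := by
    have hc := commutator_mem_of_ray hp hβp hβ hd hfN hfβ
    set f' := β ^ 2 * f * (β ^ 2)⁻¹ with hf'
    have hf's : f' ∈ supportedOn {x | ∃ k ∈ spreadList d r, x = p (k + 2 * d)} := by
      refine mul_mul_inv_mem_supportedOn hfl fun x hx => ?_
      obtain ⟨k, hk, rfl⟩ := List.mem_map.1 hx
      exact ⟨k, hk, pow_apply_ray hβp _ _⟩
    have hd_mem : d ∈ spreadList d r := mem_spreadList.2 (Or.inr (Or.inr ⟨0, by omega, by simp⟩))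
    have h3d_mem : 3 * d ∈ spreadList d r := mem_spreadList.2 (Or.inl rfl)
    have hne : ∀ x ∈ l, f x ≠ x := fun x hx =>
      (List.formPerm_apply_mem_ne_self_iff _ hnodup x hx).2 (by omega)
    have hinv : (β ^ 2)⁻¹ (p (3 * d)) = p d := by
      rw [Perm.inv_eq_iff_eq, pow_apply_ray hβp]
      congr 1
      ring
    have hq : f' (p (3 * d)) = (β ^ 2) (f (p d)) := by
      rw [hf', Perm.mul_apply, Perm.mul_apply, hinv]
    obtain ⟨j, hj, hfj⟩ := List.mem_map.1
      (List.formPerm_apply_mem_of_mem ((hmeml d).2 hd_mem) : f (p d) ∈ l)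
    have hjd : j ≠ d := by
      rintro rfl
      exact hne _ ((hmeml _).2 hd_mem) hfj.symm
    rw [← hfj, pow_apply_ray hβp] at hq
    have hqA : f' (p (3 * d)) ∉ {x | x ∈ l} := by
      rw [hq]
      exact fun h => hjd (eq_of_add_two_mul_mem_spreadList hd hj ((hmeml _).1 h))
    have hAB : ∀ x ∈ {x | x ∈ l}, x ∈ {x | ∃ k ∈ spreadList d r, x = p (k + 2 * d)} →
        x = p (3 * d) := by
      rintro x hx ⟨k, hk, rfl⟩
      have := eq_of_add_two_mul_mem_spreadList hd hk ((hmeml _).1 hx)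
      congr 1
      omega
    rw [mul_mul_inv_mul_inv_eq_swap_mul_swap hfl hf's hAB hqA] at hc
    have hfq : f (p (3 * d)) ∈ l := List.formPerm_apply_mem_of_mem ((hmeml _).2 h3d_mem)
    have h3 : HasThreeCycle Γ (f (p (3 * d))) (f' (p (3 * d))) (p (3 * d)) := by
      refine ⟨fun h => hqA ?_, fun h => hqA ?_, hne _ ((hmeml _).2 h3d_mem), hc⟩
      · rw [← h]
        exact hfq
      · rw [h]
        exact (hmeml _).2 h3d_mem
    exact h3.rotate.rotate.linked
  have hlink : ∀ k ∈ spreadList d r, Linked Γ (p d) (p k) := by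
    have h1 : ∀ k ∈ spreadList d r, Linked Γ (p (3 * d)) (p k) := by
      intro k hk
      obtain ⟨i, hi, hik⟩ := List.getElem_of_mem ((hmeml k).2 hk)
      rw [← hik, ← hl0]
      exact linked_getElem_of_formPerm hnodup hnorm (by omega) (hl0 ▸ hlink0) i hi
    intro k hk
    exact (h1 d (mem_spreadList.2 (Or.inr (Or.inr ⟨0, by omega, by simp⟩)))).symm.trans (h1 k hk)
  have hβn : ∀ t, β ^ t ∈ threeCycleNormalizer Γ := fun t =>
    le_threeCycleNormalizer (Γ.pow_mem hβ t)
  have hshift : ∀ t {j k}, Linked Γ (p (j + t * d)) (p (k + t * d)) ↔ Linked Γ (p j) (p k) := by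
    intro t j k
    rw [← pow_apply_ray hβp, ← pow_apply_ray hβp]
    exact linked_apply_iff (hβn t)
  -- `p d` is linked to its shifts by `2 * d` and `5 * d`, hence to its shift by `d`.
  have hstep : Linked Γ (p d) (p (d + d)) := by
    have h2 : Linked Γ (p d) (p (d + 2 * d)) := by
      have := hlink (3 * d) (mem_spreadList.2 (Or.inl rfl))
      rwa [show 3 * d = d + 2 * d by ring] at this
    have h5 : Linked Γ (p d) (p (d + d + 4 * d)) := by
      have := hlink (6 * d) (mem_spreadList.2 (Or.inr (Or.inl rfl)))
      rwa [show 6 * d = d + d + 4 * d by ring] at this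
    have h4 : Linked Γ (p d) (p (d + 4 * d)) := by
      have := h2.trans ((hshift 2).2 h2)
      rwa [show d + 2 * d + 2 * d = d + 4 * d by ring] at this
    exact (hshift 4).1 (h4.symm.trans h5)
  have hpow : ∀ t k, Linked Γ (p d) (p (k + t * d)) ↔ Linked Γ (p d) (p k) := by
    intro t k
    rw [← pow_apply_ray hβp]
    exact linked_pow_apply_right_iff (le_threeCycleNormalizer hβ) (Linked.refl _)
      (by rwa [hβp]) t
  intro k
  have hk : k % d < r := (Nat.mod_lt k hd).trans_le hr
  rw [← hpow (1 + 10 * (k % d)) k]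
  have e : k + (1 + 10 * (k % d)) * d = (d + (k % d) * (10 * d + 1)) + (k / d) * d := by
    nth_rw 1 [← Nat.mod_add_div k d]
    ring
  rw [e, hpow]
  exact hlink _ (mem_spreadList.2 (Or.inr (Or.inr ⟨k % d, hk, rfl⟩)))

end Ray

/-! ### Powers of the generators -/

section Generators

variable {n : ℕ} (j : Fin (n - 1))

lemma g_pow_apply_of_val_eq_zero {i : Fin n} (hi : (i : ℕ) = 0) (t m : ℕ) :
    (g n j ^ t) (i, m) = (i, m + t) := by
  induction t with
  | zero => simp
  | succ t ih =>
    rw [pow_succ', Perm.mul_apply, ih]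
    simp [g, hi, add_assoc]

lemma g_pow_apply_of_val_eq_add_one {i : Fin n} (hi : (i : ℕ) = j + 1) (t m : ℕ) :
    (g n j ^ t) (i, m + t) = (i, m) := by
  induction t with
  | zero => simp
  | succ t ih =>
    rw [pow_succ, Perm.mul_apply]
    have : g n j (i, m + (t + 1)) = (i, m + t) := by simp [g, hi, ← add_assoc]
    rw [this, ih]

lemma g_pow_apply_of_ne {i : Fin n} (hi : (i : ℕ) ≠ 0) (hi' : (i : ℕ) ≠ j + 1) (t m : ℕ) :
    (g n j ^ t) (i, m) = (i, m) := by
  induction t with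
  | zero => simp
  | succ t ih =>
    rw [pow_succ', Perm.mul_apply, ih]
    simp [g, hi, hi']

/-- A large power of `g n j` moves a point of its inward branch to the branch with number `0`. -/
lemma g_pow_apply_crossing {i : Fin n} (hi : (i : ℕ) = j + 1) (m t : ℕ) :
    (g n j ^ (t + 1 + m)) (i, m) = ((⟨0, i.pos⟩ : Fin n), t) := by
  have h1 : (g n j ^ m) (i, m) = (i, 0) := by
    simpa using g_pow_apply_of_val_eq_add_one j hi m 0
  have h2 : g n j (i, 0) = ((⟨0, i.pos⟩ : Fin n), 0) := by simp [g, hi]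
  rw [pow_add, pow_succ, Perm.mul_apply, Perm.mul_apply, h1, h2, g_pow_apply_of_val_eq_zero _ rfl,
    zero_add]

/-- The commutator of powers of two different generators is the identity away from the origin. On
the inward branch of the second generator it suffices to be at distance `b` from the origin. -/
lemma commutator_g_pow_mem_supportedOn {j k : Fin (n - 1)} (hjk : j ≠ k) (a b : ℕ) :
    g n j ^ a * (g n k ^ b)⁻¹ * (g n j ^ a)⁻¹ * (g n k ^ b)⁻¹⁻¹ ∈
      supportedOn {x : Pt n | x.2 < a + b ∧ ((x.1 : ℕ) = k + 1 → x.2 < b)} := by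
  have hjk' : (j : ℕ) ≠ k := fun h => hjk (Fin.ext h)
  refine mem_supportedOn.2 ?_
  rintro ⟨i, m⟩ hx
  simp only [Set.mem_ofPred_eq, not_and_or, not_lt, Classical.not_imp] at hx
  have hx' : a + b ≤ m ∨ (i : ℕ) = k + 1 ∧ b ≤ m := hx
  simp only [Perm.mul_apply, inv_inv]
  by_cases h0 : (i : ℕ) = 0
  · obtain ⟨m, rfl⟩ := Nat.exists_eq_add_of_le (hx'.resolve_right (by omega))
    have e₁ : (g n j ^ a)⁻¹ (i, a + b + m + b) = (i, m + b + b) := by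
      rw [Perm.inv_eq_iff_eq, g_pow_apply_of_val_eq_zero _ h0]
      congr 1; ring
    have e₂ : (g n k ^ b)⁻¹ (i, m + b + b) = (i, m + b) := by
      rw [Perm.inv_eq_iff_eq, g_pow_apply_of_val_eq_zero _ h0]
    rw [g_pow_apply_of_val_eq_zero _ h0, e₁, e₂, g_pow_apply_of_val_eq_zero _ h0]
    congr 1; ring
  by_cases hk : (i : ℕ) = k + 1
  · obtain ⟨m, rfl⟩ := Nat.exists_eq_add_of_le' (hx'.elim (by omega) And.right)
    have e₁ : ∀ m, (g n j ^ a) (i, m) = (i, m) := g_pow_apply_of_ne j h0 (by omega) a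
    have e₂ : (g n j ^ a)⁻¹ (i, m) = (i, m) := by rw [Perm.inv_eq_iff_eq, e₁]
    have e₃ : (g n k ^ b)⁻¹ (i, m) = (i, m + b) := by
      rw [Perm.inv_eq_iff_eq, g_pow_apply_of_val_eq_add_one _ hk]
    rw [g_pow_apply_of_val_eq_add_one _ hk, e₂, e₃, e₁]
  · have e₁ : ∀ m, (g n k ^ b) (i, m) = (i, m) := g_pow_apply_of_ne k h0 hk b
    have e₂ : ∀ m, (g n k ^ b)⁻¹ (i, m) = (i, m) := fun m => by rw [Perm.inv_eq_iff_eq, e₁]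
    have e₃ : ∃ m', (g n j ^ a)⁻¹ (i, m) = (i, m') := by
      by_cases hj : (i : ℕ) = j + 1
      · exact ⟨m + a, by rw [Perm.inv_eq_iff_eq, g_pow_apply_of_val_eq_add_one _ hj]⟩
      · exact ⟨m, by rw [Perm.inv_eq_iff_eq, g_pow_apply_of_ne _ h0 hj]⟩
    obtain ⟨m', hm'⟩ := e₃
    rw [e₁, hm', e₂, ← hm']
    exact (g n j ^ a).apply_symm_apply _

end Generators

/-! ### Generating `G n c` by `n - 1` elements -/

section Generation

variable {n : ℕ} {c : Fin (n - 1) → ℕ}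

/-- If the powers `g n j ^ c j` normalize the three-cycles of `Γ`, and all points of one branch are
linked, then all points of `Pt n` are linked, since the powers of the `g n j ^ c j` carry every
point through branch `0` to that branch. -/
lemma linked_of_linked_branch (hc : ∀ j, 1 ≤ c j) {Γ : Subgroup (Perm (Pt n))}
    (hnorm : ∀ j, g n j ^ c j ∈ threeCycleNormalizer Γ) {k : Fin (n - 1)} {i : Fin n}
    (hi : (i : ℕ) = k + 1) (h : ∀ m, Linked Γ (i, c k) (i, m)) (x y : Pt n) : Linked Γ x y := by
  have hfix : ∀ j, Linked Γ (i, c k) ((g n j ^ c j) (i, c k)) := by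
    intro j
    by_cases hj : j = k
    · subst hj
      have := g_pow_apply_of_val_eq_add_one j hi (c j) 0
      rw [zero_add] at this
      rw [this]
      exact h 0
    · have : (j : ℕ) ≠ k := fun e => hj (Fin.ext e)
      rw [g_pow_apply_of_ne j (by omega) (by omega)]
      exact Linked.refl _
  have hpow : ∀ j t z, Linked Γ (i, c k) ((g n j ^ (c j * t)) z) ↔ Linked Γ (i, c k) z := by
    intro j t z
    rw [pow_mul]
    exact linked_pow_apply_right_iff (hnorm j) (Linked.refl _) (hfix j) t
  have hle : ∀ j t, t ≤ c j * t := fun j t => Nat.le_mul_of_pos_left t (hc j)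
  have hzero : ∀ m, Linked Γ (i, c k) ((⟨0, i.pos⟩ : Fin n), m) := by
    intro m
    have hm := g_pow_apply_crossing k hi (c k * (m + 1) - (m + 1)) m
    rw [Nat.add_sub_cancel' (hle k (m + 1))] at hm
    rw [← hm, hpow]
    exact h _
  have hall : ∀ x, Linked Γ (i, c k) x := by
    rintro ⟨i', m⟩
    by_cases h0 : (i' : ℕ) = 0
    · have : i' = ⟨0, i.pos⟩ := Fin.ext h0
      exact this ▸ hzero m
    · have hi' := i'.isLt
      have hm := g_pow_apply_crossing (⟨i' - 1, by omega⟩ : Fin (n - 1)) (i := i')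
        (by simp only; omega) m (c ⟨i' - 1, by omega⟩ * (m + 1) - (m + 1))
      rw [add_assoc, add_comm 1 m, Nat.sub_add_cancel (hle _ _)] at hm
      rw [← hpow ⟨i' - 1, by omega⟩ (m + 1), hm]
      exact hzero _
  exact (hall x).symm.trans (hall y)

theorem exists_closure_insert_eq_G (hn : 3 ≤ n) (hc : ∀ j, 1 ≤ c j) {j₀ : Fin (n - 1)}
    (hj₀ : (j₀ : ℕ) = 0) :
    ∃ σ ∈ altGroup (Pt n),
      Subgroup.closure (insert (g n j₀ ^ c j₀ * σ)
        {h | ∃ j : Fin (n - 1), (j : ℕ) ≠ 0 ∧ h = g n j ^ c j}) = G n c := by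
  set j₁ : Fin (n - 1) := ⟨1, by omega⟩ with hj₁
  set i₂ : Fin n := ⟨2, by omega⟩ with hi₂
  set d := c j₁ with hd
  have hd0 : 0 < d := hc j₁
  set γ := g n j₀ ^ c j₀ with hγ
  set β := (g n j₁ ^ d)⁻¹ with hβ
  set p : ℕ → Pt n := fun k => (i₂, k) with hp
  have hpinj : Function.Injective p := fun a b h => congrArg Prod.snd h
  have hβp : ∀ k, β (p k) = p (k + d) := fun k => by
    rw [hβ, Perm.inv_eq_iff_eq]
    exact (g_pow_apply_of_val_eq_add_one j₁ rfl d k).symm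
  have hκ := commutator_g_pow_mem_supportedOn (n := n) (j := j₀) (k := j₁)
    (fun h => by simp [h, hj₁] at hj₀) (c j₀) d
  rw [← hγ, ← hβ] at hκ
  have hκord : IsOfFinOrder (γ * β * γ⁻¹ * β⁻¹) := by
    refine isOfFinOrder_of_mem_supportedOn (Set.Finite.subset
      ((Set.finite_univ (α := Fin n)).prod (Set.finite_Iio (c j₀ + d))) ?_) hκ
    exact fun x hx => ⟨trivial, hx.1⟩
  set e := orderOf (γ * β * γ⁻¹ * β⁻¹) with he
  have he0 : 0 < e := hκord.orderOf_pos
  -- The length of the cycle `σ` is an odd prime exceeding the order of the commutator.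
  obtain ⟨q, hqe, hq⟩ := Nat.exists_infinite_primes (e + d + 3)
  have hnodup : ((spreadList d (q - 2)).map p).Nodup := (nodup_spreadList hd0 _).map hpinj
  have hlen : ((spreadList d (q - 2)).map p).length = q := by
    rw [List.length_map, length_spreadList]
    omega
  set σ := ((spreadList d (q - 2)).map p).formPerm with hσ
  have hσalt : σ ∈ altGroup (Pt n) :=
    formPerm_mem_altGroup hnodup (by rw [hlen]; exact hq.odd_of_ne_two (by omega))
  refine ⟨σ, hσalt, ?_⟩
  set Γ := Subgroup.closure (insert (γ * σ)
    {h | ∃ j : Fin (n - 1), (j : ℕ) ≠ 0 ∧ h = g n j ^ c j}) with hΓ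
  have hγσ : γ * σ ∈ Γ := Subgroup.subset_closure (Set.mem_insert _ _)
  have hgΓ : ∀ j : Fin (n - 1), (j : ℕ) ≠ 0 → g n j ^ c j ∈ Γ := fun j hj =>
    Subgroup.subset_closure (Set.mem_insert_of_mem _ ⟨j, hj, rfl⟩)
  have hβΓ : β ∈ Γ := Γ.inv_mem (hgΓ j₁ (by simp [hj₁]))
  have hσl : σ ∈ supportedOn {x | x ∈ (spreadList d (q - 2)).map p} := formPerm_mem_supportedOn _
  have hσβl : β * σ * β⁻¹ ∈ supportedOn {x | ∃ k ∈ spreadList d (q - 2), x = p (k + d)} := by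
    refine mul_mul_inv_mem_supportedOn hσl fun x hx => ?_
    obtain ⟨k, hk, rfl⟩ := List.mem_map.1 hx
    exact ⟨k, hk, hβp k⟩
  have hσd : σ ∈ supportedOn {x : Pt n | x.1 = i₂ ∧ d ≤ x.2} := by
    refine supportedOn_mono (fun x hx => ?_) hσl
    obtain ⟨k, hk, rfl⟩ := List.mem_map.1 hx
    exact ⟨rfl, le_of_mem_spreadList hk⟩
  have hσβd : β * σ * β⁻¹ ∈ supportedOn {x : Pt n | x.1 = i₂ ∧ d ≤ x.2} := by
    refine supportedOn_mono (fun x hx => ?_) hσβl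
    obtain ⟨k, hk, rfl⟩ := hx
    exact ⟨rfl, Nat.le_add_left _ _⟩
  have hγs : γ ∈ supportedOn {x : Pt n | x.1 ≠ i₂} := by
    refine mem_supportedOn.2 fun x hx => ?_
    have hx' : x.1 = i₂ := not_not.1 hx
    refine g_pow_apply_of_ne j₀ ?_ ?_ _ _ <;> simp [hx', hi₂, hj₀]
  have hσβΓ : σ * β * σ⁻¹ ∈ Γ := by
    have hdisj : Disjoint {x : Pt n | x.2 < c j₀ + d ∧ ((x.1 : ℕ) = j₁ + 1 → x.2 < d)}
        {x : Pt n | x.1 = i₂ ∧ d ≤ x.2} := by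
      rw [Set.disjoint_left]
      rintro x ⟨-, hx⟩ ⟨hx₁, hx₂⟩
      exact absurd (hx (by rw [hx₁])) (not_lt.2 hx₂)
    refine mul_mul_inv_mem_of_coprime (γ := γ) (e := e) (p := q) hβΓ hγσ
      (commute_of_mem_supportedOn ?_ hγs hσd)
      (commute_of_mem_supportedOn hdisj hκ hσd) (commute_of_mem_supportedOn hdisj hκ hσβd)
      (commute_of_mem_supportedOn ?_ hσl hσβl) (pow_orderOf_eq_one _) ?_
      (Nat.coprime_of_lt_prime he0.ne' (by omega) hq).symm
    · exact Set.disjoint_left.2 fun x hx hx' => hx hx'.1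
    · rw [Set.disjoint_left]
      rintro x hx ⟨k, hk, rfl⟩
      exact add_notMem_spreadList hd0 hk ((List.mem_map_of_injective hpinj).1 hx)
    · have := List.formPerm_pow_length_eq_one_of_nodup _ hnodup
      rwa [hlen] at this
  obtain ⟨hσnorm, hray⟩ := linked_ray hd0 (by omega) hpinj hβp hβΓ hσβΓ
  have hgnorm : ∀ j, g n j ^ c j ∈ threeCycleNormalizer Γ := by
    intro j
    by_cases hj : (j : ℕ) = 0
    · have : j = j₀ := Fin.ext (hj.trans hj₀.symm)
      subst this
      have := mul_mem (le_threeCycleNormalizer hγσ) (inv_mem hσnorm)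
      rwa [mul_inv_cancel_right] at this
    · exact le_threeCycleNormalizer (hgΓ j hj)
  have hAlt : altGroup (Pt n) ≤ Γ :=
    altGroup_le_of_linked (linked_of_linked_branch hc hgnorm (k := j₁) (i := i₂) rfl hray)
  have hAltG : altGroup (Pt n) ≤ G n c := fun x hx => Subgroup.subset_closure (Or.inl hx)
  have hgG : ∀ j, g n j ^ c j ∈ G n c := fun j => Subgroup.subset_closure (Or.inr ⟨j, rfl⟩)
  refine le_antisymm ((Subgroup.closure_le _).2 ?_) ((Subgroup.closure_le _).2 ?_)
  · rintro x (rfl | ⟨j, -, rfl⟩)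
    · exact mul_mem (hgG j₀) (hAltG hσalt)
    · exact hgG j
  · rintro x (hx | ⟨j, rfl⟩)
    · exact hAlt hx
    · by_cases hj : (j : ℕ) = 0
      · have : j = j₀ := Fin.ext (hj.trans hj₀.symm)
        subst this
        have := mul_mem hγσ (inv_mem (hAlt hσalt))
        rwa [mul_inv_cancel_right] at this
      · exact hgΓ j hj

end Generation

/-! ### Translation lengths and the lower bound for the rank -/

section Rank

variable {n : ℕ}

/-- Sufficiently far out on each branch, `f` is the translation by `v i`, where `i` is the number
of the branch. -/
def IsTranslationBy (f : Perm (Pt n)) (v : Fin n → ℤ) : Prop :=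
  ∀ i, ∃ M : ℕ, ∀ m, M ≤ m → (f (i, m)).1 = i ∧ ((f (i, m)).2 : ℤ) = m + v i

lemma IsTranslationBy.one : IsTranslationBy (1 : Perm (Pt n)) 0 :=
  fun _ => ⟨0, fun _ _ => by simp⟩

lemma IsTranslationBy.mul {f f' : Perm (Pt n)} {v v' : Fin n → ℤ} (hf : IsTranslationBy f v)
    (hf' : IsTranslationBy f' v') : IsTranslationBy (f * f') (v + v') := by
  intro i
  obtain ⟨M, hM⟩ := hf i
  obtain ⟨M', hM'⟩ := hf' i
  refine ⟨M' + M + (v' i).natAbs, fun m hm => ?_⟩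
  obtain ⟨h₁, h₂⟩ := hM' m (by omega)
  obtain ⟨h₃, h₄⟩ := hM (f' (i, m)).2 (by omega)
  have e : f' (i, m) = (i, (f' (i, m)).2) := Prod.ext h₁ rfl
  rw [Perm.mul_apply, e]
  refine ⟨h₃, ?_⟩
  rw [h₄, h₂, Pi.add_apply]
  ring

lemma IsTranslationBy.inv {f : Perm (Pt n)} {v : Fin n → ℤ} (hf : IsTranslationBy f v) :
    IsTranslationBy f⁻¹ (-v) := by
  intro i
  obtain ⟨M, hM⟩ := hf i
  refine ⟨M + (v i).natAbs, fun m hm => ?_⟩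
  obtain ⟨k, hk⟩ : ∃ k : ℕ, (k : ℤ) = m - v i := ⟨(m - v i).toNat, by omega⟩
  obtain ⟨h₁, h₂⟩ := hM k (by omega)
  have e : f⁻¹ (i, m) = (i, k) := by
    rw [Perm.inv_eq_iff_eq]
    exact Prod.ext h₁.symm (by simp only; omega)
  rw [e]
  exact ⟨rfl, by rw [hk, Pi.neg_apply]; ring⟩

lemma IsTranslationBy.unique {f : Perm (Pt n)} {v v' : Fin n → ℤ} (hf : IsTranslationBy f v)
    (hf' : IsTranslationBy f v') : v = v' := by
  ext i
  obtain ⟨M, hM⟩ := hf i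
  obtain ⟨M', hM'⟩ := hf' i
  have h := (hM (M + M') (by omega)).2
  have h' := (hM' (M + M') (by omega)).2
  omega

lemma isTranslationBy_swap (x y : Pt n) : IsTranslationBy (swap x y) 0 := by
  refine fun i => ⟨x.2 + y.2 + 1, fun m hm => ?_⟩
  rw [swap_apply_of_ne_of_ne]
  · simp
  all_goals
    rintro rfl
    simp only at hm
    omega

lemma isTranslationBy_g_pow (j : Fin (n - 1)) (t : ℕ) : IsTranslationBy (g n j ^ t)
    fun i => if (i : ℕ) = 0 then (t : ℤ) else if (i : ℕ) = j + 1 then -t else 0 := by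
  refine fun i => ⟨t, fun m hm => ?_⟩
  by_cases h0 : (i : ℕ) = 0
  · rw [g_pow_apply_of_val_eq_zero _ h0]
    simp [h0]
  by_cases hj : (i : ℕ) = j + 1
  · obtain ⟨m, rfl⟩ := Nat.exists_eq_add_of_le' hm
    rw [g_pow_apply_of_val_eq_add_one _ hj]
    simp [hj]
  · rw [g_pow_apply_of_ne _ h0 hj]
    simp [h0, hj]

variable (n) in
/-- The permutations of `Pt n` that are eventually a translation on each branch. -/
def translations : Subgroup (Perm (Pt n)) where
  carrier := {f | ∃ v, IsTranslationBy f v}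
  one_mem' := ⟨0, .one⟩
  mul_mem' := fun ⟨_, h⟩ ⟨_, h'⟩ => ⟨_, h.mul h'⟩
  inv_mem' := fun ⟨_, h⟩ => ⟨_, h.inv⟩

lemma H_le_translations : H n ≤ translations n := by
  refine (Subgroup.closure_le _).2 ?_
  rintro _ ⟨j, rfl⟩
  exact ⟨_, by simpa using isTranslationBy_g_pow j 1⟩

lemma G_le_translations (c : Fin (n - 1) → ℕ) : G n c ≤ translations n := by
  refine (Subgroup.closure_le _).2 ?_
  rintro _ (⟨l, hl, -, rfl⟩ | ⟨j, rfl⟩)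
  · refine Subgroup.list_prod_mem _ fun τ hτ => ?_
    obtain ⟨x, y, -, rfl⟩ := hl τ hτ
    exact ⟨0, isTranslationBy_swap x y⟩
  · exact ⟨_, isTranslationBy_g_pow j _⟩

/-- The translation lengths of the generators of `K` span a rational vector space that contains
`n - 1` linearly independent vectors, namely the translation lengths of the `g n j ^ c j`. -/
theorem sub_one_le_rank {K : Subgroup (Perm (Pt n))} [Group.FG K] (hK : K ≤ translations n)
    {c : Fin (n - 1) → ℕ} (hc : ∀ j, 1 ≤ c j) (hg : ∀ j, g n j ^ c j ∈ K) :
    n - 1 ≤ Group.rank K := by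
  classical
  obtain ⟨S, hScard, hS⟩ := Group.rank_spec K
  choose v hv using fun f : K => hK f.2
  -- Only the branches with positive number are recorded.
  let φ : (Fin n → ℤ) → Fin (n - 1) → ℚ := fun v j => v ⟨j + 1, by omega⟩
  set W := Submodule.span ℚ ((S.image fun f => φ (v f) : Finset _) : Set (Fin (n - 1) → ℚ)) with hW
  have hφadd : ∀ a b, φ (a + b) = φ a + φ b := fun a b => by ext j; simp [φ]
  have hφneg : ∀ a, φ (-a) = -φ a := fun a => by ext j; simp [φ]
  have hspan : ∀ f : K, φ (v f) ∈ W := by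
    intro f
    have hf : f ∈ Subgroup.closure (S : Set K) := hS ▸ Subgroup.mem_top f
    induction hf using Subgroup.closure_induction with
    | mem f hf => exact Submodule.subset_span (Finset.mem_coe.2 (Finset.mem_image_of_mem _ hf))
    | one =>
      rw [(hv 1).unique IsTranslationBy.one]
      convert W.zero_mem
      ext j
      simp [φ]
    | mul f f' _ _ h h' =>
      rw [(hv (f * f')).unique ((hv f).mul (hv f')), hφadd]
      exact W.add_mem h h'
    | inv f _ h =>
      rw [(hv f⁻¹).unique (hv f).inv, hφneg]
      exact W.neg_mem h
  have htop : W = ⊤ := by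
    rw [eq_top_iff, ← (Pi.basisFun ℚ (Fin (n - 1))).span_eq, Submodule.span_le]
    rintro _ ⟨j, rfl⟩
    have hcj : (c j : ℚ) ≠ 0 := by exact_mod_cast (Nat.one_le_iff_ne_zero.1 (hc j))
    have h := W.smul_mem (-(c j : ℚ)⁻¹) (hspan ⟨_, hg j⟩)
    rw [(hv ⟨_, hg j⟩).unique (isTranslationBy_g_pow j (c j))] at h
    refine (congrArg (· ∈ W) ?_).mpr h
    ext k
    by_cases hk : k = j
    · subst hk
      simp [φ, hcj]
    · have hk' : (k : ℕ) ≠ j := fun e => hk (Fin.ext e)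
      simp [φ, hk', hk]
  calc n - 1 = Module.finrank ℚ W := by rw [htop, finrank_top, Module.finrank_fin_fun]
    _ ≤ (S.image fun f => φ (v f)).card := finrank_span_finset_le_card _
    _ ≤ S.card := Finset.card_image_le
    _ = Group.rank K := hScard

/-- A subgroup of `translations n` generated by a family indexed by `Fin (n - 1)` has rank `n - 1`
as soon as it contains positive powers of all `g n j`. -/
theorem fg_and_rank_eq_of_closure_range {K : Subgroup (Perm (Pt n))} {s : Fin (n - 1) → Perm (Pt n)}
    (hs : Subgroup.closure (Set.range s) = K) (hK : K ≤ translations n)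
    {c : Fin (n - 1) → ℕ} (hc : ∀ j, 1 ≤ c j) (hg : ∀ j, g n j ^ c j ∈ K) :
    ∃ _ : Group.FG K, Group.rank K = n - 1 := by
  subst hs
  refine ⟨inferInstance, le_antisymm ?_ (sub_one_le_rank hK hc hg)⟩
  refine (Subgroup.rank_closure_finite_le_nat_card _).trans ?_
  simpa using Finite.card_range_le s

end Rank

end Houghton

/-- Permutations act on the right in the mathematical text, so the product `σ g_2^{c_2}` (first `σ`,
then `g_2^{c_2}`) is `g_2^{c_2} * σ` for the composition of functions used by Lean. -/
theorem mainTheorem3 (n : ℕ) (hn : 3 ≤ n) (c : Fin (n - 1) → ℕ) (hc : ∀ j, 1 ≤ c j) :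
    (∃ (_ : Group.FG (Houghton.H n)) (_ : Group.FG (Houghton.G n c)),
      Group.rank (Houghton.G n c) = Group.rank (Houghton.H n) ∧
      Group.rank (Houghton.H n) = n - 1) ∧
    ∃ σ ∈ Houghton.altGroup (Houghton.Pt n),
      Subgroup.closure
        (insert (Houghton.g n ⟨0, by omega⟩ ^ c ⟨0, by omega⟩ * σ)
          {h | ∃ j : Fin (n - 1), (j : ℕ) ≠ 0 ∧ h = Houghton.g n j ^ c j}) =
      Houghton.G n c := by
  obtain ⟨σ, hσ, hgen⟩ := Houghton.exists_closure_insert_eq_G hn hc (j₀ := ⟨0, by omega⟩) rfl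
  refine ⟨?_, σ, hσ, hgen⟩
  have hrange : insert (Houghton.g n ⟨0, by omega⟩ ^ c ⟨0, by omega⟩ * σ)
      {h | ∃ j : Fin (n - 1), (j : ℕ) ≠ 0 ∧ h = Houghton.g n j ^ c j} =
      Set.range fun j : Fin (n - 1) => Houghton.g n j ^ c j * if (j : ℕ) = 0 then σ else 1 := by
    ext h
    constructor
    · rintro (rfl | ⟨j, hj, rfl⟩)
      · exact ⟨⟨0, by omega⟩, by simp⟩
      · exact ⟨j, by simp [hj]⟩
    · rintro ⟨j, rfl⟩
      by_cases hj : (j : ℕ) = 0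
      · have : j = ⟨0, by omega⟩ := Fin.ext hj
        exact Or.inl (by simp [this])
      · exact Or.inr ⟨j, hj, by simp [hj]⟩
  obtain ⟨hG, hGrank⟩ := Houghton.fg_and_rank_eq_of_closure_range (hrange ▸ hgen)
    (Houghton.G_le_translations c) hc fun j => Subgroup.subset_closure (Or.inr ⟨j, rfl⟩)
  obtain ⟨hH, hHrank⟩ := Houghton.fg_and_rank_eq_of_closure_range (K := Houghton.H n) rfl
    Houghton.H_le_translations (c := fun _ => 1) (fun _ => le_rfl)
    fun j => by
      rw [pow_one]
      exact Subgroup.subset_closure (Set.mem_range_self j)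
  exact ⟨hH, hG, hGrank.trans hHrank.symm, hHrank⟩
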